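/- Let $K$ be a field and let $I\subseteq K[x_1,\dots,x_n]$ be a monomial ideal whose minimal monomial generators $f_1,\dots,f_m$ all have the same degree $d$. Let $M$ be the largest exponent with which a variable occurs in $f_1,\dots,f_m$, assume $M\ge 2$, and write $d=aM+b$ with $a,b\in\mathbb N$, $b<M$ and $a\ge 1$. Put $\operatorname{sign}(b)=1$ if $b>0$ and $\operatorname{sign}(0)=0$. In $R=K[x_1,\dots,x_n,y_1,\dots,y_m]$ consider the $*$-linearization $$\mathrm{LIN}(I)=\big(x_1^{a_1}\cdots x_n^{a_n}\;\big|\; a_1+\dots+a_n=d,\ a_i\le M\text{ for all }i\big)+\big(\tfrac{f_j}{x_k}y_j\;\big|\; x_k\text{ divides } f_j,\ 1\le k\le n,\ 1\le j\le m\big).$$ Call a generator $f_j$ pathological if exactly one variable occurs in it with exponent $1$ and all other variables dividing $f_j$ occur in it with exponent $M$. List the pathological generators, in any order, as $f_{j_1},\dots,f_{j_p}$ without repetition, let $x_{k_\ell}$ be the variable occurring with exponent $1$ in $f_{j_\ell}$, and put $$t_\ell=\#\Big\{s\in\{1,\dots,\ell-1\}\;\Big|\;\frac{f_{j_s}}{x_{k_s}}=\frac{f_{j_\ell}}{x_{k_\ell}}\Big\}.$$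 Then the total Betti numbers of the ideal $\sqrt{\mathrm{LIN}(I)}$ over $R$, that is, the ranks of the free modules $F_i$ in its minimal graded free resolution $\cdots\to F_1\to F_0\to\sqrt{\mathrm{LIN}(I)}\to 0$, are, for all $i\ge 0$, $$\beta_i\big(\sqrt{\mathrm{LIN}(I)}\big)=\binom{i+a+\operatorname{sign}(b)-1}{a+\operatorname{sign}(b)-1}\binom{n}{i+a+\operatorname{sign}(b)}+\sum_{\ell=1}^{p}\binom{n-a+t_\ell}{i}.$$ -/

import Mathlib

open MvPolynomial

/-- An ideal of a polynomial ring is a monomial ideal if it is generated by monomials. -/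
def IsMonomialIdeal {K : Type*} [Field K] {σ : Type*} (I : Ideal (MvPolynomial σ K)) : Prop :=
  ∃ S : Set (σ →₀ ℕ), I = Ideal.span ((fun u => monomial u (1 : K)) '' S)

/-- `G(I)`: the exponent vectors of the monomials in `I` that are minimal under divisibility
(divisibility of monomials is the componentwise order of exponent vectors). -/
def minimalGenerators {K : Type*} [Field K] {σ : Type*} (I : Ideal (MvPolynomial σ K)) :
    Set (σ →₀ ℕ) :=
  {u | Minimal (fun v => monomial v (1 : K) ∈ I) u}

/-- An exponent vector in `x_1, …, x_n`, seen as one in `x_1, …, x_n, y_1, …, y_m`.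
The variable `x_i` is indexed by `Sum.inl i` and `y_j` by `Sum.inr j`. -/
noncomputable def xExponent {n : ℕ} (m : ℕ) (u : Fin n →₀ ℕ) : (Fin n ⊕ Fin m) →₀ ℕ :=
  u.mapDomain Sum.inl

/-- The monomials `x_1 ^ a_1 ⋯ x_n ^ a_n` of degree `d` with all `a_i ≤ M`. -/
def completePartGenerators (K : Type*) [Field K] (n m d M : ℕ) :
    Set (MvPolynomial (Fin n ⊕ Fin m) K) :=
  {g | ∃ u : Fin n →₀ ℕ, (∑ i, u i) = d ∧ (∀ i, u i ≤ M) ∧ g = monomial (xExponent m u) 1}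

/-- The monomials `(f_j / x_k) y_j`, where `x_k` divides `f_j`. -/
def lastPartGenerators (K : Type*) [Field K] {n m : ℕ} (f : Fin m → (Fin n →₀ ℕ)) :
    Set (MvPolynomial (Fin n ⊕ Fin m) K) :=
  {g | ∃ (j : Fin m) (k : Fin n), 1 ≤ f j k ∧
    g = monomial (xExponent m (f j - Finsupp.single k 1)) 1 * X (Sum.inr j)}

/-- The `*`-linearization of the ideal minimally generated by the monomials with exponent
vectors `f_1, …, f_m`, all of degree `d`, with largest occurring exponent `M`. -/
noncomputable def starLinearization (K : Type*) [Field K] {n m : ℕ} (d M : ℕ) (f : Fin m → (Fin n →₀ ℕ)) :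
    Ideal (MvPolynomial (Fin n ⊕ Fin m) K) :=
  Ideal.span (completePartGenerators K n m d M) ⊔ Ideal.span (lastPartGenerators K f)

/-- Exactly one variable occurs with exponent `1`, and all the other variables that occur
have exponent `M` (used for `M ≥ 2`). -/
def IsPathological {n : ℕ} (M : ℕ) (u : Fin n →₀ ℕ) : Prop :=
  ∃ k, u k = 1 ∧ ∀ l, l ≠ k → u l = 0 ∨ u l = M

/-- `sign b` is `1` if `b > 0` and `0` if `b = 0`. -/
def natSign (b : ℕ) : ℕ := if 0 < b then 1 else 0

/-- `p` lies in the homogeneous component of degree `z` of the polynomial ring with its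
standard grading, extended by zero to negative degrees. -/
def InDegree {K : Type*} [Field K] {σ : Type*} (z : ℤ) (p : MvPolynomial σ K) : Prop :=
  p = 0 ∨ ∃ e : ℕ, (e : ℤ) = z ∧ p.IsHomogeneous e

/-- `v` lies in the degree `z` component of the graded free module `⨁_k R(-deg k)`. -/
def VecInDegree {K : Type*} [Field K] {σ : Type*} {r : ℕ} (deg : Fin r → ℤ) (z : ℤ)
    (v : Fin r → MvPolynomial σ K) : Prop :=
  ∀ k, InDegree (z - deg k) (v k)

/-- A minimal graded free resolution `⋯ → F_1 → F_0 → J → 0` of an ideal `J` of the polynomial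
ring `R` over `K` with variables indexed by `σ`, where `F_i = ⨁_k R(-deg i k)` has rank
`rank i`. -/
structure MinimalGradedFreeResolution {K : Type*} [Field K] {σ : Type*}
    (J : Ideal (MvPolynomial σ K)) where
  rank : ℕ → ℕ
  deg : (i : ℕ) → Fin (rank i) → ℤ
  diff : (i : ℕ) →
    (Fin (rank (i + 1)) → MvPolynomial σ K) →ₗ[MvPolynomial σ K]
      (Fin (rank i) → MvPolynomial σ K)
  aug : (Fin (rank 0) → MvPolynomial σ K) →ₗ[MvPolynomial σ K] MvPolynomial σ K
  range_aug : LinearMap.range aug = J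
  exact_zero : Function.Exact (diff 0) aug
  exact_succ : ∀ i, Function.Exact (diff (i + 1)) (diff i)
  aug_graded : ∀ z v, VecInDegree (deg 0) z v → InDegree z (aug v)
  diff_graded : ∀ i z v, VecInDegree (deg (i + 1)) z v → VecInDegree (deg i) z (diff i v)
  minimal : ∀ i v k, diff i v k ∈ Ideal.span (Set.range (X : σ → MvPolynomial σ K))

/-- The total Betti numbers of `J` are `β 0, β 1, …`: the ideal `J` has a minimal graded free
resolution, and in every such resolution the `i`-th module has rank `β i`. -/
def HasTotalBettiNumbers {K : Type*} [Field K] {σ : Type*} (J : Ideal (MvPolynomial σ K))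
    (β : ℕ → ℕ) : Prop :=
  Nonempty (MinimalGradedFreeResolution J) ∧
    ∀ (F : MinimalGradedFreeResolution J) (i : ℕ), F.rank i = β i

/-- For a list of monomials `f_{j_1}, …, f_{j_p}` and variables `x_{k_1}, …, x_{k_p}`, the number
`t_ℓ` of indices `s < ℓ` with `f_{j_s} / x_{k_s} = f_{j_ℓ} / x_{k_ℓ}`. -/
noncomputable def earlierCoincidences {n m p : ℕ} (f : Fin m → (Fin n →₀ ℕ)) (j : Fin p → Fin m)
    (k : Fin p → Fin n) (l : Fin p) : ℕ :=
  (Finset.univ.filter (fun s : Fin p => s < l ∧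
    f (j s) - Finsupp.single (k s) 1 = f (j l) - Finsupp.single (k l) 1)).card

/-! Put q = a + sign(b), which is d/M rounded up. A monomial of degree d with exponents at most M
involves at least q variables, and every set of q variables carries such a monomial. So the first
summand of LIN(I) contributes to the radical exactly the squarefree monomials of degree q in the
x's. A generator (f_j/x_k) y_j adds nothing new if f_j/x_k still involves q variables. Otherwise its
degree d - 1 fills the remaining variables completely: all exponents are M, so f_j is pathological
with simple variable x_k, b = 1 and q = a + 1. The new generator is then x_A y_j, where A, the
support of f_j/x_k, has a elements. Hence the radical is generated in the single degree q
(`starLinearization_radical`).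

This ideal has linear quotients. With the q-sets in colexicographic order, the colon ideal at x_B is
generated by the x_i with i a gap of B. Adding then the monomials x_A y_j in the given order, the
colon ideal at the ℓ-th is generated by the n - a variables x_i outside A and by the t_ℓ variables y
of earlier generators with the same A. A colon ideal generated by c variables has a Koszul
resolution, and the mapping cone adds binom(c, i) to the i-th rank
(`HasLinearResolution.linear_quotients`). All entries stay linear, so the cone is minimal. Summing
over gap numbers gives the first term of the formula (`sum_choose_card_gaps`). The ranks do not
depend on the minimal resolution (`MinimalGradedFreeResolution.rank_eq`). -/

open Matrix

/-- A linear free resolution of an ideal generated in degree `q`: a row `aug` of forms of degree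
`q` generating the ideal, followed by matrices of linear forms. -/
structure LinearResolution {K σ : Type*} [Field K] (J : Ideal (MvPolynomial σ K)) (q : ℕ) where
  ι : ℕ → Type
  fin : ∀ i, Fintype (ι i)
  aug : ι 0 → MvPolynomial σ K
  D : ∀ i, Matrix (ι i) (ι (i + 1)) (MvPolynomial σ K)
  aug_hom : ∀ k, (aug k).IsHomogeneous q
  D_hom : ∀ i k l, (D i k l).IsHomogeneous 1
  mem_iff : ∀ r, r ∈ J ↔ ∃ v, aug ⬝ᵥ v = r
  exact_zero : ∀ v, aug ⬝ᵥ v = 0 ↔ ∃ w, D 0 *ᵥ w = v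
  exact_succ : ∀ i v, D i *ᵥ v = 0 ↔ ∃ w, D (i + 1) *ᵥ w = v

attribute [instance] LinearResolution.fin

/-- The ideal `J` has a linear resolution in degree `q` with ranks `β`. -/
def HasLinearResolution {K σ : Type*} [Field K] (J : Ideal (MvPolynomial σ K)) (q : ℕ)
    (β : ℕ → ℕ) : Prop :=
  ∃ F : LinearResolution J q, ∀ i, Fintype.card (F.ι i) = β i

/-! ### Homogeneous solutions of linear systems -/

section HomogeneousLift

variable {K σ : Type*} [Field K]

theorem homogeneousComponent_mul_of_isHomogeneous {a b : ℕ} {p : MvPolynomial σ K}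
    (hp : p.IsHomogeneous a) (r : MvPolynomial σ K) :
    homogeneousComponent (a + b) (p * r) = p * homogeneousComponent b r := by
  classical
  conv_lhs => rw [← sum_homogeneousComponent r, Finset.mul_sum, map_sum]
  have h : ∀ i, homogeneousComponent (a + b) (p * homogeneousComponent i r) =
      if i = b then p * homogeneousComponent b r else 0 := by
    intro i
    rw [homogeneousComponent_of_mem (hp.mul (homogeneousComponent_isHomogeneous i r))]
    by_cases hi : i = b
    · simp [hi]
    · simp [hi, Ne.symm hi]
  simp only [h, Finset.sum_ite_eq', Finset.mem_range]
  split_ifs with hb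
  · rfl
  · rw [homogeneousComponent_eq_zero _ _ (by omega), mul_zero]

/-- A solvable linear system with homogeneous matrix and right-hand side has a homogeneous
solution. -/
theorem exists_homogeneous_mul_eq {ι κ μ : Type*} [Fintype κ] {a b : ℕ}
    {A : Matrix ι κ (MvPolynomial σ K)} {B : Matrix ι μ (MvPolynomial σ K)}
    (hA : ∀ i k, (A i k).IsHomogeneous a) (hB : ∀ i k, (B i k).IsHomogeneous (a + b))
    (h : ∀ l, ∃ w, A *ᵥ w = fun i => B i l) :
    ∃ T : Matrix κ μ (MvPolynomial σ K), (∀ i k, (T i k).IsHomogeneous b) ∧ A * T = B := by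
  choose w hw using h
  refine ⟨Matrix.of fun k l => homogeneousComponent b (w l k),
    fun k l => homogeneousComponent_isHomogeneous _ _, ?_⟩
  ext1 i l
  simp only [Matrix.mul_apply, Matrix.of_apply]
  simp_rw [← homogeneousComponent_mul_of_isHomogeneous (hA i _)]
  rw [← map_sum]
  have := congrFun (hw l) i
  simp only [Matrix.mulVec, dotProduct] at this
  rw [this, homogeneousComponent_eq_self (hB i l)]

theorem isHomogeneous_mul_apply {ι κ μ : Type*} [Fintype κ] {a b : ℕ}
    {A : Matrix ι κ (MvPolynomial σ K)} {B : Matrix κ μ (MvPolynomial σ K)}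
    (hA : ∀ i k, (A i k).IsHomogeneous a) (hB : ∀ i k, (B i k).IsHomogeneous b) (i : ι) (l : μ) :
    ((A * B) i l).IsHomogeneous (a + b) :=
  IsHomogeneous.sum _ _ _ fun k _ => (hA i k).mul (hB k l)

end HomogeneousLift

theorem Sum.elim_eq_elim {α β γ : Type*} {f f' : α → γ} {g g' : β → γ}
    (h : Sum.elim f g = Sum.elim f' g') : f = f' ∧ g = g' :=
  ⟨funext fun a => congrFun h (Sum.inl a), funext fun b => congrFun h (Sum.inr b)⟩

/-! ### Chain maps and mapping cones of linear resolutions -/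

namespace LinearResolution

variable {K σ : Type*} [Field K] {J L : Ideal (MvPolynomial σ K)} {q e : ℕ}

theorem D_mul_D (F : LinearResolution J q) (i : ℕ) : F.D i * F.D (i + 1) = 0 := by
  classical
  refine Matrix.ext_of_mulVec_single fun l => ?_
  rw [← Matrix.mulVec_mulVec, (F.exact_succ i _).2 ⟨_, rfl⟩, Matrix.zero_mulVec]

theorem D_mulVec_D_mulVec (F : LinearResolution J q) (i : ℕ) (v) :
    F.D i *ᵥ (F.D (i + 1) *ᵥ v) = 0 := (F.exact_succ i _).2 ⟨_, rfl⟩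

theorem aug_vecMul_D (F : LinearResolution J q) : F.aug ᵥ* F.D 0 = 0 := by
  classical
  ext1 l
  have := (F.exact_zero _).2 ⟨Pi.single l 1, rfl⟩
  rwa [Matrix.dotProduct_mulVec, dotProduct_single, mul_one] at this

/-- The row `g • aug` of `G` lifts along `F`. -/
theorem exists_lift_zero (F : LinearResolution J q) (G : LinearResolution L e)
    {g : MvPolynomial σ K} (hg : g.IsHomogeneous q) (hL : ∀ r ∈ L, g * r ∈ J) :
    ∃ T : Matrix (F.ι 0) (G.ι 0) (MvPolynomial σ K), (∀ i k, (T i k).IsHomogeneous e) ∧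
      F.aug ᵥ* T = g • G.aug := by
  classical
  obtain ⟨T, hT, h⟩ := exists_homogeneous_mul_eq (a := q) (b := e)
    (A := Matrix.replicateRow Unit F.aug) (B := Matrix.replicateRow Unit (g • G.aug))
    (fun _ k => F.aug_hom k) (fun _ k => hg.mul (G.aug_hom k)) (fun l => by
      have : g * G.aug l ∈ J := hL _ ((G.mem_iff _).2 ⟨Pi.single l 1, by simp⟩)
      obtain ⟨w, hw⟩ := (F.mem_iff _).1 this
      exact ⟨w, by ext1 i; simpa [Matrix.mulVec] using hw⟩)
  refine ⟨T, hT, ?_⟩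
  ext1 l
  have := congrFun (congrFun h ()) l
  simpa [Matrix.mul_apply, Matrix.vecMul, dotProduct] using this

/-- The predicate on degree `i` maps needed to continue a chain map `G → F`. -/
def Liftable (F : LinearResolution J q) (G : LinearResolution L e) (i : ℕ)
    (T : Matrix (F.ι i) (G.ι i) (MvPolynomial σ K)) : Prop :=
  (∀ k l, (T k l).IsHomogeneous e) ∧
    ∃ S : Matrix (F.ι (i + 1)) (G.ι (i + 1)) (MvPolynomial σ K), F.D i * S = T * G.D i

/-- Since D_i (S D_{i+1}) = T D_i D_{i+1} = 0, exactness of `F` lifts the columns of S D_{i+1}; this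
keeps the recursion going. -/
theorem Liftable.exists_next {F : LinearResolution J q} {G : LinearResolution L e} {i : ℕ}
    {T : Matrix (F.ι i) (G.ι i) (MvPolynomial σ K)} (hT : Liftable F G i T) :
    ∃ S, Liftable F G (i + 1) S ∧ F.D i * S = T * G.D i := by
  classical
  obtain ⟨hhom, S₀, hS₀⟩ := hT
  obtain ⟨S, hS, h⟩ := exists_homogeneous_mul_eq (a := 1) (b := e) (A := F.D i) (B := T * G.D i)
    (F.D_hom i) (fun k l => add_comm e 1 ▸ isHomogeneous_mul_apply hhom (G.D_hom i) k l)
    (fun l => ⟨S₀.col l, by ext1 k; rw [← hS₀]; rfl⟩)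
  refine ⟨S, ⟨hS, ?_⟩, h⟩
  have hz : F.D i * (S * G.D (i + 1)) = 0 := by
    rw [← Matrix.mul_assoc, h, Matrix.mul_assoc, G.D_mul_D, Matrix.mul_zero]
  have hcol : ∀ l, ∃ w, F.D (i + 1) *ᵥ w = fun k => (S * G.D (i + 1)) k l := fun l =>
    (F.exact_succ i _).1 (by
      ext1 k
      exact congrFun (congrFun hz k) l)
  choose w hw using hcol
  refine ⟨Matrix.of fun k l => w l k, ?_⟩
  ext1 k l
  exact congrFun (hw l) k

theorem exists_lift (F : LinearResolution J q) (G : LinearResolution L e)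
    {g : MvPolynomial σ K} (hg : g.IsHomogeneous q) (hL : ∀ r ∈ L, g * r ∈ J) :
    ∃ T : ∀ i, Matrix (F.ι i) (G.ι i) (MvPolynomial σ K),
      (∀ i k l, (T i k l).IsHomogeneous e) ∧ F.aug ᵥ* T 0 = g • G.aug ∧
      ∀ i, F.D i * T (i + 1) = T i * G.D i := by
  classical
  obtain ⟨T₀, hhom, h₀⟩ := exists_lift_zero F G hg hL
  have hl : Liftable F G 0 T₀ := by
    refine ⟨hhom, ?_⟩
    have hcol : ∀ l, ∃ w, F.D 0 *ᵥ w = fun k => (T₀ * G.D 0) k l := fun l =>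
      (F.exact_zero _).1 (by
        have : F.aug ᵥ* (T₀ * G.D 0) = 0 := by
          rw [← Matrix.vecMul_vecMul, h₀, Matrix.smul_vecMul, G.aug_vecMul_D, smul_zero]
        exact congrFun this l)
    choose w hw using hcol
    refine ⟨Matrix.of fun k l => w l k, ?_⟩
    ext1 k l
    exact congrFun (hw l) k
  let T : ∀ i, {T // Liftable F G i T} := fun i => Nat.rec ⟨T₀, hl⟩
    (fun _ T => ⟨T.2.exists_next.choose, T.2.exists_next.choose_spec.1⟩) i
  exact ⟨fun i => (T i).1, fun i => (T i).2.1, h₀, fun i => (T i).2.exists_next.choose_spec.2⟩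

/-- The index types of the mapping cone. -/
def ConeIndex (F : LinearResolution J q) (G : LinearResolution L 1) : ℕ → Type
  | 0 => F.ι 0 ⊕ Unit
  | i + 1 => F.ι (i + 1) ⊕ G.ι i

instance coneFintype (F : LinearResolution J q) (G : LinearResolution L 1) :
    ∀ i, Fintype (ConeIndex F G i)
  | 0 => inferInstanceAs (Fintype (F.ι 0 ⊕ Unit))
  | i + 1 => inferInstanceAs (Fintype (F.ι (i + 1) ⊕ G.ι i))

/-- The differentials of the mapping cone. -/
noncomputable def coneD (F : LinearResolution J q) (G : LinearResolution L 1)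
    (T : ∀ i, Matrix (F.ι i) (G.ι i) (MvPolynomial σ K)) :
    ∀ i, Matrix (ConeIndex F G i) (ConeIndex F G (i + 1)) (MvPolynomial σ K)
  | 0 => Matrix.fromBlocks (F.D 0) (T 0) 0 (-Matrix.replicateRow Unit G.aug)
  | i + 1 => Matrix.fromBlocks (F.D (i + 1)) (T (i + 1)) 0 (-G.D i)

theorem coneD_zero_mulVec (F : LinearResolution J q) (G : LinearResolution L 1)
    (T : ∀ i, Matrix (F.ι i) (G.ι i) (MvPolynomial σ K)) (v : F.ι 1 → MvPolynomial σ K)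
    (w : G.ι 0 → MvPolynomial σ K) :
    coneD F G T 0 *ᵥ (Sum.elim v w : F.ι 1 ⊕ G.ι 0 → MvPolynomial σ K) =
      (Sum.elim (F.D 0 *ᵥ v + T 0 *ᵥ w) (fun _ => -(G.aug ⬝ᵥ w)) :
        F.ι 0 ⊕ Unit → MvPolynomial σ K) := by
  refine (Matrix.fromBlocks_mulVec _ _ _ _ _).trans ?_
  ext1 (k | k) <;> simp [Matrix.neg_mulVec, Matrix.mulVec]

theorem coneD_succ_mulVec (F : LinearResolution J q) (G : LinearResolution L 1)
    (T : ∀ i, Matrix (F.ι i) (G.ι i) (MvPolynomial σ K)) (i : ℕ)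
    (v : F.ι (i + 2) → MvPolynomial σ K) (w : G.ι (i + 1) → MvPolynomial σ K) :
    coneD F G T (i + 1) *ᵥ (Sum.elim v w : F.ι (i + 2) ⊕ G.ι (i + 1) → MvPolynomial σ K) =
      (Sum.elim (F.D (i + 1) *ᵥ v + T (i + 1) *ᵥ w) (-(G.D i *ᵥ w)) :
        F.ι (i + 1) ⊕ G.ι i → MvPolynomial σ K) := by
  refine (Matrix.fromBlocks_mulVec _ _ _ _ _).trans ?_
  ext1 (k | k) <;> simp [Matrix.neg_mulVec]

/-- The mapping cone of a lift of multiplication by `g` resolves `J + (g)`. -/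
noncomputable def cone (F : LinearResolution J q) (G : LinearResolution L 1)
    {g : MvPolynomial σ K} (hg : g.IsHomogeneous q) (hL : ∀ r, r ∈ L ↔ g * r ∈ J)
    (T : ∀ i, Matrix (F.ι i) (G.ι i) (MvPolynomial σ K))
    (hT : ∀ i k l, (T i k l).IsHomogeneous 1) (hT0 : F.aug ᵥ* T 0 = g • G.aug)
    (hTS : ∀ i, F.D i * T (i + 1) = T i * G.D i) :
    LinearResolution (J ⊔ Ideal.span {g}) q where
  ι := ConeIndex F G
  fin := coneFintype F G
  aug := (Sum.elim F.aug fun _ => g : F.ι 0 ⊕ Unit → MvPolynomial σ K)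
  D := coneD F G T
  aug_hom := by
    rintro (k | k)
    · exact F.aug_hom k
    · exact hg
  D_hom := by
    rintro (_ | i) (k | k) (l | l)
    · exact F.D_hom _ _ _
    -- The lift is linear because `G` starts in degree 1; this is what keeps the cone linear.
    · exact hT _ _ _
    · exact isHomogeneous_zero _ _ _
    · exact (G.aug_hom _).neg
    · exact F.D_hom _ _ _
    · exact hT _ _ _
    · exact isHomogeneous_zero _ _ _
    · exact (G.D_hom _ _ _).neg
  mem_iff := by
    intro r
    rw [Submodule.mem_sup]
    constructor
    · rintro ⟨y, hy, z, hz, rfl⟩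
      obtain ⟨v, rfl⟩ := (F.mem_iff _).1 hy
      obtain ⟨c, rfl⟩ := Ideal.mem_span_singleton'.1 hz
      refine ⟨(Sum.elim v fun _ => c : F.ι 0 ⊕ Unit → MvPolynomial σ K), ?_⟩
      refine (sumElim_dotProduct_sumElim _ _ _ _).trans ?_
      simp [dotProduct, mul_comm]
    · rintro ⟨v, rfl⟩
      obtain ⟨v, c, rfl⟩ : ∃ v₁ v₂, v = (Sum.elim v₁ v₂ : F.ι 0 ⊕ Unit → MvPolynomial σ K) :=
        ⟨v ∘ Sum.inl, v ∘ Sum.inr, (Sum.elim_comp_inl_inr v).symm⟩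
      refine ⟨F.aug ⬝ᵥ v, (F.mem_iff _).2 ⟨v, rfl⟩, c () * g,
        Ideal.mem_span_singleton'.2 ⟨_, rfl⟩, ?_⟩
      refine Eq.symm ((sumElim_dotProduct_sumElim _ _ _ _).trans ?_)
      simp [dotProduct, mul_comm]
  exact_zero := by
    intro v
    obtain ⟨v, c, rfl⟩ : ∃ v₁ v₂, v = (Sum.elim v₁ v₂ : F.ι 0 ⊕ Unit → MvPolynomial σ K) :=
      ⟨v ∘ Sum.inl, v ∘ Sum.inr, (Sum.elim_comp_inl_inr v).symm⟩
    have hTu : ∀ u, F.aug ⬝ᵥ (T 0 *ᵥ u) = g * (G.aug ⬝ᵥ u) := fun u => by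
      rw [Matrix.dotProduct_mulVec, hT0, smul_dotProduct, smul_eq_mul]
    have haug : ∀ (v : F.ι 0 → MvPolynomial σ K) (c : Unit → MvPolynomial σ K),
        (Sum.elim F.aug (fun _ => g) : F.ι 0 ⊕ Unit → MvPolynomial σ K) ⬝ᵥ Sum.elim v c =
          F.aug ⬝ᵥ v + g * c () := fun v c => by
      rw [sumElim_dotProduct_sumElim]
      simp [dotProduct]
    constructor
    · intro h
      replace h := (haug v c).symm.trans h
      -- A relation puts g c in J, so c lies in the colon ideal and lifts to some u; correcting v by
      -- T u leaves a syzygy of `F`. The witness carries -u to match the sign of the `G` block. The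
      -- higher degrees repeat this argument.
      have hc : c () ∈ L := by
        rw [hL, ← neg_mem_iff, ← eq_neg_of_add_eq_zero_left h, F.mem_iff]
        exact ⟨v, rfl⟩
      obtain ⟨u, hu⟩ := (G.mem_iff _).1 hc
      have h2 : F.aug ⬝ᵥ (v + T 0 *ᵥ u) = 0 := by
        rw [dotProduct_add, hTu, hu, h]
      obtain ⟨w, hw⟩ := (F.exact_zero _).1 h2
      refine ⟨(Sum.elim w (-u) : F.ι 1 ⊕ G.ι 0 → MvPolynomial σ K), ?_⟩
      refine (coneD_zero_mulVec F G T _ _).trans ?_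
      rw [hw, Matrix.mulVec_neg, dotProduct_neg, hu, add_neg_cancel_right, neg_neg]
    · rintro ⟨w, hw⟩
      obtain ⟨w, u, rfl⟩ : ∃ v₁ v₂, w = (Sum.elim v₁ v₂ : F.ι 1 ⊕ G.ι 0 → MvPolynomial σ K) :=
        ⟨w ∘ Sum.inl, w ∘ Sum.inr, (Sum.elim_comp_inl_inr w).symm⟩
      have hw' := (coneD_zero_mulVec F G T _ _).symm.trans hw
      obtain ⟨rfl, rfl⟩ := Sum.elim_eq_elim hw'
      refine (haug _ _).trans ?_
      rw [dotProduct_add, (F.exact_zero _).2 ⟨_, rfl⟩, hTu]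
      ring
  exact_succ := by
    rintro (_ | i) v
    · obtain ⟨v, u, rfl⟩ : ∃ v₁ v₂, v = (Sum.elim v₁ v₂ : F.ι 1 ⊕ G.ι 0 → MvPolynomial σ K) :=
        ⟨v ∘ Sum.inl, v ∘ Sum.inr, (Sum.elim_comp_inl_inr v).symm⟩
      have key : coneD F G T 0 *ᵥ (Sum.elim v u : F.ι 1 ⊕ G.ι 0 → MvPolynomial σ K) = 0 ↔
          F.D 0 *ᵥ v + T 0 *ᵥ u = 0 ∧ G.aug ⬝ᵥ u = 0 := by
        rw [coneD_zero_mulVec]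
        constructor
        · intro h
          exact ⟨funext fun k => congrFun h (Sum.inl k),
            neg_eq_zero.1 (congrFun h (Sum.inr ()))⟩
        · rintro ⟨h1, h2⟩
          ext1 (k | k)
          · exact congrFun h1 k
          · exact neg_eq_zero.2 h2
      refine key.trans ⟨?_, ?_⟩
      · rintro ⟨h1, h2⟩
        obtain ⟨s, rfl⟩ := (G.exact_zero _).1 h2
        have h3 : F.D 0 *ᵥ (v + T 1 *ᵥ s) = 0 := by
          rw [Matrix.mulVec_add, Matrix.mulVec_mulVec, hTS, ← Matrix.mulVec_mulVec, h1]
        obtain ⟨w, hw⟩ := (F.exact_succ _ _).1 h3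
        refine ⟨(Sum.elim w (-s) : F.ι 2 ⊕ G.ι 1 → MvPolynomial σ K), ?_⟩
        refine (coneD_succ_mulVec F G T _ _ _).trans ?_
        rw [hw, Matrix.mulVec_neg, Matrix.mulVec_neg, neg_neg, add_neg_cancel_right]
      · rintro ⟨w, hw⟩
        obtain ⟨w, s, rfl⟩ : ∃ v₁ v₂, w = (Sum.elim v₁ v₂ : F.ι 2 ⊕ G.ι 1 → MvPolynomial σ K) :=
          ⟨w ∘ Sum.inl, w ∘ Sum.inr, (Sum.elim_comp_inl_inr w).symm⟩
        have hw' := (coneD_succ_mulVec F G T _ _ _).symm.trans hw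
        obtain ⟨rfl, rfl⟩ := Sum.elim_eq_elim hw'
        rw [Matrix.mulVec_add, F.D_mulVec_D_mulVec, Matrix.mulVec_mulVec, hTS,
          ← Matrix.mulVec_mulVec, Matrix.mulVec_neg, dotProduct_neg,
          (G.exact_zero _).2 ⟨_, rfl⟩]
        simp
    · obtain ⟨v, u, rfl⟩ :
          ∃ v₁ v₂, v = (Sum.elim v₁ v₂ : F.ι (i + 2) ⊕ G.ι (i + 1) → MvPolynomial σ K) :=
        ⟨v ∘ Sum.inl, v ∘ Sum.inr, (Sum.elim_comp_inl_inr v).symm⟩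
      have key : coneD F G T (i + 1) *ᵥ
          (Sum.elim v u : F.ι (i + 2) ⊕ G.ι (i + 1) → MvPolynomial σ K) = 0 ↔
          F.D (i + 1) *ᵥ v + T (i + 1) *ᵥ u = 0 ∧ G.D i *ᵥ u = 0 := by
        rw [coneD_succ_mulVec]
        constructor
        · intro h
          exact ⟨funext fun k => congrFun h (Sum.inl k),
            neg_eq_zero.1 (funext fun k => congrFun h (Sum.inr k))⟩
        · rintro ⟨h1, h2⟩
          ext1 (k | k)
          · exact congrFun h1 k
          · exact congrFun (neg_eq_zero.2 h2) k
      refine key.trans ⟨?_, ?_⟩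
      · rintro ⟨h1, h2⟩
        obtain ⟨s, rfl⟩ := (G.exact_succ _ _).1 h2
        have h3 : F.D (i + 1) *ᵥ (v + T (i + 2) *ᵥ s) = 0 := by
          rw [Matrix.mulVec_add, Matrix.mulVec_mulVec, hTS, ← Matrix.mulVec_mulVec, h1]
        obtain ⟨w, hw⟩ := (F.exact_succ _ _).1 h3
        refine ⟨(Sum.elim w (-s) : F.ι (i + 3) ⊕ G.ι (i + 2) → MvPolynomial σ K), ?_⟩
        refine (coneD_succ_mulVec F G T _ _ _).trans ?_
        rw [hw, Matrix.mulVec_neg, Matrix.mulVec_neg, neg_neg, add_neg_cancel_right]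
      · rintro ⟨w, hw⟩
        obtain ⟨w, s, rfl⟩ :
            ∃ v₁ v₂, w = (Sum.elim v₁ v₂ : F.ι (i + 3) ⊕ G.ι (i + 2) → MvPolynomial σ K) :=
          ⟨w ∘ Sum.inl, w ∘ Sum.inr, (Sum.elim_comp_inl_inr w).symm⟩
        have hw' := (coneD_succ_mulVec F G T _ _ _).symm.trans hw
        obtain ⟨rfl, rfl⟩ := Sum.elim_eq_elim hw'
        rw [Matrix.mulVec_add, F.D_mulVec_D_mulVec, Matrix.mulVec_mulVec, hTS,
          ← Matrix.mulVec_mulVec, Matrix.mulVec_neg, Matrix.mulVec_neg, G.D_mulVec_D_mulVec]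
        simp

end LinearResolution

/-- Adding a form `g` of degree `q` with linearly resolved colon ideal `J : g`. -/
theorem HasLinearResolution.sup_span_singleton {K σ : Type*} [Field K]
    {J L : Ideal (MvPolynomial σ K)} {q : ℕ} {β γ δ : ℕ → ℕ} (hJ : HasLinearResolution J q β)
    (hLres : HasLinearResolution L 1 γ) {g : MvPolynomial σ K} (hg : g.IsHomogeneous q)
    (hL : ∀ r, r ∈ L ↔ g * r ∈ J) (hδ0 : δ 0 = β 0 + 1) (hδ : ∀ i, δ (i + 1) = β (i + 1) + γ i) :
    HasLinearResolution (J ⊔ Ideal.span {g}) q δ := by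
  obtain ⟨F, hF⟩ := hJ
  obtain ⟨G, hG⟩ := hLres
  obtain ⟨T, hT, hT0, hTS⟩ := F.exists_lift G hg fun r hr => (hL r).1 hr
  refine ⟨F.cone G hg hL T hT hT0 hTS, ?_⟩
  rintro (_ | i)
  · rw [hδ0, ← hF]
    exact (Fintype.card_sum).trans (by simp)
  · rw [hδ, ← hF, ← hG]
    exact Fintype.card_sum

theorem hasLinearResolution_bot {K σ : Type*} [Field K] (q : ℕ) :
    HasLinearResolution (⊥ : Ideal (MvPolynomial σ K)) q 0 :=
  ⟨{ ι := fun _ => Empty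
     fin := fun _ => inferInstance
     aug := fun k => k.elim
     D := fun _ k => k.elim
     aug_hom := fun k => k.elim
     D_hom := fun _ k => k.elim
     mem_iff := fun r => by simp [eq_comm]
     exact_zero := fun v => by simp [eq_iff_true_of_subsingleton]
     exact_succ := fun i v => by simp [eq_iff_true_of_subsingleton] }, fun _ => rfl⟩

/-! ### Squarefree monomial ideals and linear quotients -/

section SquarefreeMonomialIdeal

variable {K σ : Type*} [Field K]

/-- The exponent vector of the squarefree monomial with support `A`. -/
noncomputable def squarefreeExponent (A : Finset σ) : σ →₀ ℕ := Finsupp.indicator A fun _ _ => 1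

theorem squarefreeExponent_apply [DecidableEq σ] (A : Finset σ) (i : σ) :
    squarefreeExponent A i = if i ∈ A then 1 else 0 := by
  simp [squarefreeExponent, Finsupp.indicator_apply]

theorem squarefreeExponent_le_iff {A : Finset σ} {e : σ →₀ ℕ} :
    squarefreeExponent A ≤ e ↔ A ⊆ e.support := by
  classical
  simp only [Finsupp.le_def, squarefreeExponent_apply, Finset.subset_iff, Finsupp.mem_support_iff]
  refine forall_congr' fun i => ?_
  by_cases h : i ∈ A <;> simp [h, Nat.one_le_iff_ne_zero]

theorem support_squarefreeExponent (A : Finset σ) : (squarefreeExponent A).support = A := by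
  classical
  ext i
  simp [squarefreeExponent_apply]

theorem degree_squarefreeExponent (A : Finset σ) : (squarefreeExponent A).degree = A.card := by
  classical
  rw [Finsupp.degree_apply, support_squarefreeExponent, Finset.card_eq_sum_ones]
  exact Finset.sum_congr rfl fun i hi => by simp [squarefreeExponent_apply, hi]

variable (K) in
/-- The ideal generated by the squarefree monomials with supports in `S`. -/
noncomputable def squarefreeIdeal (S : Set (Finset σ)) : Ideal (MvPolynomial σ K) :=
  Ideal.span ((fun A => monomial (squarefreeExponent A) (1 : K)) '' S)

theorem mem_squarefreeIdeal {S : Set (Finset σ)} {r : MvPolynomial σ K} :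
    r ∈ squarefreeIdeal K S ↔ ∀ e ∈ r.support, ∃ A ∈ S, A ⊆ e.support := by
  have : (fun A => monomial (squarefreeExponent A) (1 : K)) '' S =
      (fun s => monomial s (1 : K)) '' (squarefreeExponent '' S) := by
    rw [Set.image_image]
  rw [squarefreeIdeal, this, mem_ideal_span_monomial_image]
  simp [squarefreeExponent_le_iff]

theorem squarefreeIdeal_insert (S : Set (Finset σ)) (B : Finset σ) :
    squarefreeIdeal K (insert B S) =
      squarefreeIdeal K S ⊔ Ideal.span {monomial (squarefreeExponent B) (1 : K)} := by
  rw [squarefreeIdeal, squarefreeIdeal, Set.image_insert_eq, Ideal.span_insert, sup_comm]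

theorem squarefreeIdeal_empty : squarefreeIdeal K (∅ : Set (Finset σ)) = ⊥ := by
  simp [squarefreeIdeal]

theorem squarefreeIdeal_singletons (T : Set σ) :
    squarefreeIdeal K ((fun i => ({i} : Finset σ)) '' T) =
      Ideal.span (X '' T : Set (MvPolynomial σ K)) := by
  ext r
  rw [mem_squarefreeIdeal, mem_ideal_span_X_image]
  simp

/-- Colon ideals of squarefree monomial ideals generated by variables. -/
theorem mem_span_X_iff_mul_mem_squarefreeIdeal {S : Set (Finset σ)} {B : Finset σ} {T : Set σ}
    (h1 : ∀ A ∈ S, ∃ i ∈ T, i ∈ A ∧ i ∉ B)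
    (h2 : ∀ i ∈ T, ∃ A ∈ S, ∀ j ∈ A, j ∈ B ∨ j = i) (r : MvPolynomial σ K) :
    r ∈ Ideal.span (X '' T : Set (MvPolynomial σ K)) ↔
      monomial (squarefreeExponent B) 1 * r ∈ squarefreeIdeal K S := by
  classical
  rw [mem_ideal_span_X_image, mem_squarefreeIdeal]
  have hsupp : ∀ e : σ →₀ ℕ, (squarefreeExponent B + e).support = B ∪ e.support := by
    intro e
    ext i
    simp [squarefreeExponent_apply]
    tauto
  -- `h2` puts the variables of `T` into the colon ideal; `h1` shows that they generate it.
  constructor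
  · intro h e he
    obtain ⟨e, rfl⟩ : ∃ e', e = squarefreeExponent B + e' := by
      by_contra hne
      rw [mem_support_iff, coeff_monomial_mul', if_neg] at he
      · exact he rfl
      · exact fun hle => hne ⟨e - squarefreeExponent B, (add_tsub_cancel_of_le hle).symm⟩
    rw [mem_support_iff, coeff_monomial_mul, one_mul, ← mem_support_iff] at he
    obtain ⟨i, hi, hei⟩ := h e he
    obtain ⟨A, hA, hAB⟩ := h2 i hi
    refine ⟨A, hA, fun j hj => ?_⟩
    rw [hsupp, Finset.mem_union]
    rcases hAB j hj with hj | rfl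
    · exact Or.inl hj
    · exact Or.inr (Finsupp.mem_support_iff.2 hei)
  · intro h e he
    obtain ⟨A, hA, hAe⟩ := h (squarefreeExponent B + e) (by
      rwa [mem_support_iff, coeff_monomial_mul, one_mul, ← mem_support_iff])
    obtain ⟨i, hi, hiA, hiB⟩ := h1 A hA
    have := hAe hiA
    rw [hsupp, Finset.mem_union] at this
    exact ⟨i, hi, Finsupp.mem_support_iff.1 (this.resolve_left hiB)⟩

/-- Ideals generated by variables are resolved by the Koszul complex. -/
theorem hasLinearResolution_span_X (T : Finset σ) :
    HasLinearResolution (Ideal.span (X '' (T : Set σ) : Set (MvPolynomial σ K))) 1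
      fun i => T.card.choose (i + 1) := by
  classical
  induction T using Finset.induction_on with
  | empty =>
    have := hasLinearResolution_bot (K := K) (σ := σ) 1
    convert this using 1
    · simp
    · ext i
      simp
  | insert x T hx ih =>
    have hT : Ideal.span (X '' ((insert x T : Finset σ) : Set σ) : Set (MvPolynomial σ K)) =
        Ideal.span (X '' (T : Set σ)) ⊔ Ideal.span {X x} := by
      rw [Finset.coe_insert, Set.image_insert_eq, Ideal.span_insert, sup_comm]
    rw [hT]
    -- The variable x is regular modulo the others, so the ideal is its own colon ideal, and the
    -- ranks add by Pascal's rule.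
    refine ih.sup_span_singleton ih (isHomogeneous_X K x) (fun r => ?_) ?_ fun i => ?_
    · have := mem_span_X_iff_mul_mem_squarefreeIdeal (K := K)
        (S := (fun i => ({i} : Finset σ)) '' (T : Set σ)) (B := {x}) (T := (T : Set σ))
        (by
          rintro _ ⟨i, hi, rfl⟩
          exact ⟨i, hi, by simp, by rintro h; simp at h; exact hx (h ▸ hi)⟩)
        (fun i hi => ⟨{i}, ⟨i, hi, rfl⟩, by simp⟩) r
      rw [squarefreeIdeal_singletons] at this
      rw [this]
      have hX : monomial (squarefreeExponent {x}) (1 : K) = X x := by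
        rw [X]
        congr 2
        ext i
        simp [squarefreeExponent_apply, Finsupp.single_apply, eq_comm]
      rw [hX]
    · simp [Finset.card_insert_of_notMem hx]
    · simp only [Finset.card_insert_of_notMem hx]
      rw [Nat.choose_succ_succ', add_comm]

/-- Linear quotients: adding, in increasing order, squarefree monomials of degree `q` whose
successive colon ideals are generated by variables. -/
theorem HasLinearResolution.linear_quotients {α : Type*} [LinearOrder α] {q : ℕ}
    {S : Set (Finset σ)} {β : ℕ → ℕ} (hS : HasLinearResolution (squarefreeIdeal K S) q β)
    (g : α → Finset σ) (T : α → Finset σ) (N : Finset α)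
    (hcard : ∀ B ∈ N, (g B).card = q)
    (h1 : ∀ B ∈ N, ∀ A, A ∈ S ∨ (∃ C ∈ N, C < B ∧ g C = A) → ∃ i ∈ T B, i ∈ A ∧ i ∉ g B)
    (h2 : ∀ B ∈ N, ∀ i ∈ T B, ∃ A, (A ∈ S ∨ ∃ C ∈ N, C < B ∧ g C = A) ∧
      ∀ j ∈ A, j ∈ g B ∨ j = i) :
    HasLinearResolution (squarefreeIdeal K (S ∪ g '' (N : Set α))) q
      fun i => β i + ∑ B ∈ N, (T B).card.choose i := by
  classical
  -- The largest index is adjoined last, so the predecessors of the other indices do not change.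
  induction N using Finset.induction_on_max with
  | empty => simpa using hS
  | insert B N hB ih =>
    have hlt : ∀ D ∈ N, ∀ A, (∃ C ∈ insert B N, C < D ∧ g C = A) ↔ ∃ C ∈ N, C < D ∧ g C = A := by
      intro D hD A
      constructor
      · rintro ⟨C, hC, hCD, rfl⟩
        rcases Finset.mem_insert.1 hC with rfl | hC
        · exact absurd (hB D hD) hCD.not_gt
        · exact ⟨C, hC, hCD, rfl⟩
      · rintro ⟨C, hC, h⟩
        exact ⟨C, Finset.mem_insert_of_mem hC, h⟩
    have hBN : B ∉ N := fun h => lt_irrefl _ (hB B h)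
    have hmem : ∀ A, A ∈ S ∪ g '' (N : Set α) ↔
        (A ∈ S ∨ ∃ C ∈ insert B N, C < B ∧ g C = A) := by
      intro A
      refine or_congr_right ⟨?_, ?_⟩
      · rintro ⟨C, hC, rfl⟩
        exact ⟨C, Finset.mem_insert_of_mem hC, hB C hC, rfl⟩
      · rintro ⟨C, hC, hCB, rfl⟩
        rcases Finset.mem_insert.1 hC with rfl | hC
        · exact absurd hCB (lt_irrefl _)
        · exact ⟨C, hC, rfl⟩
    have ih' := ih (fun D hD => hcard D (Finset.mem_insert_of_mem hD))
      (fun D hD A hA => h1 D (Finset.mem_insert_of_mem hD) A (by rwa [hlt D hD]))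
      (fun D hD i hi => by
        simpa only [hlt D hD] using h2 D (Finset.mem_insert_of_mem hD) i hi)
    have hset : S ∪ g '' ((insert B N : Finset α) : Set α) =
        insert (g B) (S ∪ g '' (N : Set α)) := by
      rw [Finset.coe_insert, Set.image_insert_eq, Set.union_insert]
    rw [hset, squarefreeIdeal_insert]
    refine ih'.sup_span_singleton (hasLinearResolution_span_X (T B))
      (isHomogeneous_monomial _ ?_) (fun r => ?_) ?_ fun i => ?_
    · rw [degree_squarefreeExponent, hcard B (Finset.mem_insert_self _ _)]
    · refine mem_span_X_iff_mul_mem_squarefreeIdeal (fun A hA => ?_) (fun i hi => ?_) r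
      · exact h1 B (Finset.mem_insert_self _ _) A ((hmem A).1 hA)
      · obtain ⟨A, hA, h⟩ := h2 B (Finset.mem_insert_self _ _) i hi
        exact ⟨A, (hmem A).2 hA, h⟩
    · rw [Finset.sum_insert hBN]
      simp
      ring
    · rw [Finset.sum_insert hBN]
      ring

/-- Squarefree monomial ideals are radical. -/
theorem squarefreeIdeal_isRadical (S : Set (Finset σ)) : (squarefreeIdeal K S).IsRadical := by
  classical
  rintro r ⟨k, hk⟩
  rw [mem_squarefreeIdeal]
  by_contra! hcon
  obtain ⟨e, he, hbad⟩ := hcon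
  -- `φ` kills the variables absent from the bad monomial e, hence the ideal, hence r, as the target
  -- is a domain. But r - φ r lies in the ideal of the killed variables, so e would contain one of
  -- them.
  let T : Set σ := {i | e i = 0}
  let φ : MvPolynomial σ K →ₐ[K] MvPolynomial σ K := aeval fun i => if e i = 0 then 0 else X i
  have hkill : squarefreeIdeal K S ≤ RingHom.ker φ := by
    rw [squarefreeIdeal, Ideal.span_le]
    rintro _ ⟨A, hA, rfl⟩
    obtain ⟨i, hi, hie⟩ := Finset.not_subset.1 (hbad A hA)
    have hie : e i = 0 := by simpa using hie
    simp only [SetLike.mem_coe, RingHom.mem_ker]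
    rw [aeval_monomial, Finsupp.prod, Finset.prod_eq_zero (i := i), mul_zero]
    · rwa [support_squarefreeExponent]
    · simp [hie, squarefreeExponent_apply, hi]
  have hφ : φ r = 0 := by
    have := hkill hk
    rw [RingHom.mem_ker, map_pow] at this
    exact eq_zero_of_pow_eq_zero this
  have hcongr : ∀ s : MvPolynomial σ K, s - φ s ∈ Ideal.span (X '' T) := by
    intro s
    rw [← Ideal.Quotient.eq]
    have : (Ideal.Quotient.mkₐ K (Ideal.span (X '' T : Set (MvPolynomial σ K)))) =
        (Ideal.Quotient.mkₐ K _).comp φ := by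
      refine algHom_ext fun i => ?_
      simp only [φ, AlgHom.comp_apply, aeval_X]
      split_ifs with hi
      · rw [map_zero, Ideal.Quotient.mkₐ_eq_mk, Ideal.Quotient.eq_zero_iff_mem]
        exact Ideal.subset_span ⟨i, hi, rfl⟩
      · rfl
    exact DFunLike.congr_fun this s
  have hr := hcongr r
  rw [hφ, sub_zero, mem_ideal_span_X_image] at hr
  obtain ⟨i, hi, hne⟩ := hr e he
  exact hne hi

end SquarefreeMonomialIdeal

/-! ### Summing binomials of gap numbers -/

section Counting

/-- Induction on n: each of the binom(n, p) new sets has maximum n and n - p gaps. Their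
contribution binom(n, p) binom(n - p, i) equals binom(n, i + p) binom(i + p, p), and Pascal's rule
finishes. -/
theorem sum_powersetCard_range_choose_card_gaps (n p i : ℕ) :
    ∑ B ∈ Finset.powersetCard (p + 1) (Finset.range n),
      (Finset.range (B.sup id) \ B).card.choose i =
        (i + p).choose p * n.choose (i + p + 1) := by
  induction n with
  | zero => simp
  | succ n ih =>
    have hn : n ∉ Finset.range n := by simp
    rw [Finset.range_add_one, Finset.powersetCard_succ_insert hn, Finset.sum_union, ih,
      Finset.sum_image]
    · have h : ∀ B ∈ Finset.powersetCard p (Finset.range n),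
          (Finset.range ((insert n B).sup id) \ insert n B).card.choose i = (n - p).choose i := by
        intro B hB
        obtain ⟨hB, hc⟩ := Finset.mem_powersetCard.1 hB
        have hsup : (insert n B).sup id = n := by
          rw [Finset.sup_insert, id, sup_eq_left]
          exact Finset.sup_le fun b hb => (Finset.mem_range.1 (hB hb)).le
        have hsd : Finset.range n \ insert n B = Finset.range n \ B := by
          rw [Finset.sdiff_insert_of_notMem hn]
        rw [hsup, hsd, Finset.card_sdiff_of_subset hB, hc, Finset.card_range]
      rw [Finset.sum_congr rfl h, Finset.sum_const, Finset.card_powersetCard, Finset.card_range,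
        smul_eq_mul, Nat.choose_succ_succ' n (i + p), mul_add, add_comm]
      have := Nat.choose_mul (n := n) (k := i + p) (s := p) (by omega)
      rw [Nat.add_sub_cancel] at this
      rw [← this, mul_comm (n.choose (i + p))]
    · intro B hB C hC h
      have hB := (Finset.mem_powersetCard.1 hB).1
      have hC := (Finset.mem_powersetCard.1 hC).1
      rw [← Finset.erase_insert fun h => hn (hB h), ← Finset.erase_insert fun h => hn (hC h)]
      exact congrArg (Finset.erase · n) h
    · rw [Finset.disjoint_left]
      intro B hB hB'
      obtain ⟨C, -, rfl⟩ := Finset.mem_image.1 hB'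
      exact hn ((Finset.mem_powersetCard.1 hB).1 (Finset.mem_insert_self _ _))

/-- The elements below the maximum of `B` and not in `B`. -/
def gaps {n : ℕ} (B : Finset (Fin n)) : Finset (Fin n) :=
  Finset.univ.filter fun j => j ∉ B ∧ ∃ b ∈ B, j < b

theorem map_gaps {n : ℕ} (B : Finset (Fin n)) :
    (gaps B).map Fin.valEmbedding =
      Finset.range ((B.map Fin.valEmbedding).sup id) \ B.map Fin.valEmbedding := by
  ext x
  simp only [gaps, Finset.mem_map, Finset.mem_filter, Finset.mem_univ, true_and,
    Finset.mem_sdiff, Finset.mem_range, Finset.lt_sup_iff, Fin.valEmbedding_apply, id]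
  constructor
  · rintro ⟨j, ⟨hj, b, hb, hjb⟩, rfl⟩
    refine ⟨⟨b, ⟨b, hb, rfl⟩, hjb⟩, ?_⟩
    rintro ⟨c, hc, h⟩
    exact hj (Fin.ext h ▸ hc)
  · rintro ⟨⟨_, ⟨b, hb, rfl⟩, hxb⟩, hx⟩
    exact ⟨⟨x, hxb.trans b.2⟩, ⟨fun h => hx ⟨_, h, rfl⟩, b, hb, hxb⟩, rfl⟩

theorem sum_choose_card_gaps (n p i : ℕ) :
    ∑ B ∈ Finset.powersetCard (p + 1) (Finset.univ : Finset (Fin n)), (gaps B).card.choose i =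
      (i + p).choose p * n.choose (i + p + 1) := by
  have hr : Finset.range n = (Finset.univ : Finset (Fin n)).map Fin.valEmbedding := by
    ext x
    simp only [Finset.mem_range, Finset.mem_map, Finset.mem_univ, true_and]
    exact ⟨fun h => ⟨⟨x, h⟩, rfl⟩, fun ⟨j, h⟩ => h ▸ j.2⟩
  rw [← sum_powersetCard_range_choose_card_gaps, hr, Finset.powersetCard_map, Finset.sum_map]
  refine Finset.sum_congr rfl fun B _ => ?_
  rw [← Finset.card_map Fin.valEmbedding, map_gaps]
  rfl

end Counting

/-! ### Linear quotients for the squarefree Veronese ideal and its extension -/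

section Veronese

variable {K : Type*} [Field K]

/-- The supports, in the first set of variables, of the squarefree monomials of degree `q`. -/
def veroneseSupports (n m q : ℕ) : Set (Finset (Fin n ⊕ Fin m)) :=
  (fun B : Finset (Fin n) => B.map Function.Embedding.inl) '' {B | B.card = q}

/-- If C precedes B in colex order, any x in C \ B lies below some element of B, so it is a gap.
Conversely, exchanging a larger element of B for a gap x gives an earlier set contained in B ∪ {x}.
-/
theorem hasLinearResolution_veronese (n m p : ℕ) :
    HasLinearResolution (squarefreeIdeal K (veroneseSupports n m (p + 1))) (p + 1)
      fun i => (i + p).choose p * n.choose (i + p + 1) := by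
  classical
  have h0 : HasLinearResolution (squarefreeIdeal K (∅ : Set (Finset (Fin n ⊕ Fin m)))) (p + 1) 0 :=
    squarefreeIdeal_empty (K := K) (σ := Fin n ⊕ Fin m) ▸ hasLinearResolution_bot (p + 1)
  let N : Finset (Colex (Finset (Fin n))) :=
    (Finset.powersetCard (p + 1) (Finset.univ : Finset (Fin n))).map toColex.toEmbedding
  have hN : ∀ B : Colex (Finset (Fin n)), B ∈ N ↔ (ofColex B).card = p + 1 := by
    intro B
    simp only [N, Finset.mem_map, Finset.mem_powersetCard_univ, Equiv.coe_toEmbedding]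
    exact ⟨fun ⟨C, hC, h⟩ => h ▸ hC, fun h => ⟨ofColex B, h, rfl⟩⟩
  have key := h0.linear_quotients
    (fun B : Colex (Finset (Fin n)) => (ofColex B).map Function.Embedding.inl)
    (fun B => (gaps (ofColex B)).map Function.Embedding.inl) N
    (fun B hB => by rw [Finset.card_map]; exact (hN B).1 hB)
    (by
      rintro B hB A (hA | ⟨C, hC, hCB, rfl⟩)
      · exact absurd hA (Set.notMem_empty _)
      · have hlt : toColex (ofColex C) < toColex (ofColex B) := hCB
        rw [Finset.Colex.toColex_lt_toColex] at hlt
        obtain ⟨hne, hlt⟩ := hlt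
        have hns : ¬ ofColex C ⊆ ofColex B := fun hs =>
          hne (Finset.eq_of_subset_of_card_le hs (((hN B).1 hB).trans ((hN C).1 hC).symm).le)
        obtain ⟨x, hxC, hxB⟩ := Finset.not_subset.1 hns
        obtain ⟨b, hbB, hbC, hxb⟩ := hlt hxC hxB
        refine ⟨Sum.inl x, ?_, ?_, ?_⟩
        · refine Finset.mem_map.2 ⟨x, ?_, rfl⟩
          simp only [gaps, Finset.mem_filter, Finset.mem_univ, true_and]
          exact ⟨hxB, b, hbB, lt_of_le_of_ne hxb fun h => hxB (h ▸ hbB)⟩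
        · exact Finset.mem_map.2 ⟨x, hxC, rfl⟩
        · rintro h
          obtain ⟨y, hy, h⟩ := Finset.mem_map.1 h
          exact hxB (Sum.inl_injective h ▸ hy))
    (by
      intro B hB i hi
      obtain ⟨x, hx, rfl⟩ := Finset.mem_map.1 hi
      simp only [gaps, Finset.mem_filter, Finset.mem_univ, true_and] at hx
      obtain ⟨hxB, b, hbB, hxb⟩ := hx
      refine ⟨(insert x ((ofColex B).erase b)).map Function.Embedding.inl,
        Or.inr ⟨toColex (insert x ((ofColex B).erase b)), ?_, ?_, rfl⟩, ?_⟩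
      · rw [hN, ofColex_toColex, Finset.card_insert_of_notMem (fun h => hxB
          (Finset.mem_of_mem_erase h)), Finset.card_erase_of_mem hbB, (hN B).1 hB]
        rfl
      · change toColex (insert x ((ofColex B).erase b)) < toColex (ofColex B)
        rw [Finset.Colex.toColex_lt_toColex]
        refine ⟨fun h => hxB (h ▸ Finset.mem_insert_self _ _), ?_⟩
        intro y hy hyB
        rcases Finset.mem_insert.1 hy with rfl | hy
        · refine ⟨b, hbB, ?_, hxb.le⟩
          simp [hxb.ne']
        · exact absurd (Finset.mem_of_mem_erase hy) hyB
      · intro y hy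
        obtain ⟨y, hy', rfl⟩ := Finset.mem_map.1 hy
        rcases Finset.mem_insert.1 hy' with rfl | hy
        · exact Or.inr rfl
        · exact Or.inl (Finset.mem_map.2 ⟨y, Finset.mem_of_mem_erase hy, rfl⟩))
  have hset : (∅ : Set (Finset (Fin n ⊕ Fin m))) ∪
      (fun B : Colex (Finset (Fin n)) => (ofColex B).map Function.Embedding.inl) '' (N : Set _) =
      veroneseSupports n m (p + 1) := by
    rw [Set.empty_union]
    ext A
    constructor
    · rintro ⟨B, hB, rfl⟩
      exact ⟨ofColex B, (hN B).1 hB, rfl⟩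
    · rintro ⟨B, hB, rfl⟩
      exact ⟨toColex B, (hN _).2 hB, rfl⟩
  rw [hset] at key
  convert key using 2 with i
  rw [Finset.sum_map]
  simp only [Finset.card_map, Pi.zero_apply, zero_add]
  exact (sum_choose_card_gaps n p i).symm

/-- Adjoining to the squarefree Veronese ideal of degree `a + 1` monomials `x_A y_j` with
`|A| = a` and distinct `y_j`. -/
theorem hasLinearResolution_veronese_union {n m p a : ℕ} (A : Fin p → Finset (Fin n))
    (hA : ∀ l, (A l).card = a) (j : Fin p → Fin m) (hj : Function.Injective j) :
    HasLinearResolution (squarefreeIdeal K (veroneseSupports n m (a + 1) ∪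
        Set.range fun l => (A l).disjSum {j l})) (a + 1)
      fun i => (i + a).choose a * n.choose (i + a + 1) +
        ∑ l, (n - a + (Finset.univ.filter fun s => s < l ∧ A s = A l).card).choose i := by
  classical
  have key := (hasLinearResolution_veronese (K := K) n m a).linear_quotients
    (fun l => (A l).disjSum {j l})
    -- The x-variables come from the Veronese sets A ∪ {x}, the y-variables from earlier generators
    -- with the same A. An earlier generator with another A of equal size already contains an x
    -- outside A.
    (fun l => (A l)ᶜ.disjSum ((Finset.univ.filter fun s => s < l ∧ A s = A l).image j))
    Finset.univ
    (fun l _ => by rw [Finset.card_disjSum, hA, Finset.card_singleton])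
    (by
      rintro l - _ (⟨B, hB, rfl⟩ | ⟨s, -, hs, rfl⟩)
      · have : ¬ B ⊆ A l := fun h => by
          have := Finset.card_le_card h
          rw [hA l, hB] at this
          omega
        obtain ⟨x, hx, hxA⟩ := Finset.not_subset.1 this
        exact ⟨Sum.inl x, by simpa using hxA, by simpa using hx, by simpa using hxA⟩
      · by_cases hAs : A s = A l
        · refine ⟨Sum.inr (j s), ?_, by simp, by simpa using fun h => hs.ne (hj h)⟩
          simpa using ⟨s, ⟨hs, hAs⟩, rfl⟩
        · have : ¬ A s ⊆ A l := fun h =>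
            hAs (Finset.eq_of_subset_of_card_le h (by rw [hA, hA]))
          obtain ⟨x, hx, hxA⟩ := Finset.not_subset.1 this
          exact ⟨Sum.inl x, by simpa using hxA, by simpa using hx, by simpa using hxA⟩)
    (by
      rintro l - (x | y) hi
      · have hx : x ∉ A l := by simpa using hi
        refine ⟨(insert x (A l)).map Function.Embedding.inl, Or.inl ⟨insert x (A l), ?_, rfl⟩, ?_⟩
        · simp [Finset.card_insert_of_notMem hx, hA]
        · intro z hz
          obtain ⟨z, hz', rfl⟩ := Finset.mem_map.1 hz
          rcases Finset.mem_insert.1 hz' with rfl | hz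
          · exact Or.inr rfl
          · exact Or.inl (by simpa using hz)
      · obtain ⟨s, ⟨hs, hAs⟩, rfl⟩ : ∃ s, (s < l ∧ A s = A l) ∧ j s = y := by simpa using hi
        refine ⟨_, Or.inr ⟨s, Finset.mem_univ _, hs, rfl⟩, ?_⟩
        rintro (z | z) hz
        · exact Or.inl (by simpa [hAs] using hz)
        · exact Or.inr (by simpa using hz))
  convert key using 2 with i
  · simp
  · refine congrArg _ (Finset.sum_congr rfl fun l _ => ?_)
    rw [Finset.card_disjSum, Finset.card_image_of_injective _ hj, Finset.card_compl, hA,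
      Fintype.card_fin]

end Veronese

/-! ### Uniqueness of the ranks of minimal resolutions -/

section ComparisonOfResolutions

theorem LinearMap.exists_comp_eq {R M N : Type*} [CommRing R] [AddCommGroup M] [Module R M]
    [AddCommGroup N] [Module R N] {r : ℕ} (f : (Fin r → R) →ₗ[R] N) (g : M →ₗ[R] N)
    (h : ∀ x, f x ∈ Set.range g) : ∃ l : (Fin r → R) →ₗ[R] M, ∀ x, g (l x) = f x := by
  choose y hy using fun k => h (Pi.basisFun R (Fin r) k)
  refine ⟨(Pi.basisFun R (Fin r)).constr R y, fun x => ?_⟩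
  have : g ∘ₗ (Pi.basisFun R (Fin r)).constr R y = f :=
    (Pi.basisFun R (Fin r)).ext fun k => by rw [LinearMap.comp_apply, Module.Basis.constr_basis, hy]
  exact LinearMap.congr_fun this x

theorem LinearMap.apply_mem_ideal {R : Type*} [CommRing R] {r s : ℕ} (I : Ideal R)
    (f : (Fin r → R) →ₗ[R] (Fin s → R)) {v : Fin r → R} (hv : ∀ k, v k ∈ I) (l : Fin s) :
    f v l ∈ I := by
  rw [pi_eq_sum_univ' v, map_sum, Finset.sum_apply]
  refine Ideal.sum_mem _ fun k _ => ?_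
  rw [map_smul, Pi.smul_apply, smul_eq_mul]
  exact Ideal.mul_mem_right _ _ (hv k)

namespace MinimalGradedFreeResolution

variable {K σ : Type*} [Field K] {J : Ideal (MvPolynomial σ K)}

/-- The comparison theorem for free resolutions; `P` records that the next lift exists. The grading
plays no role. -/
theorem exists_chainMap (F G : MinimalGradedFreeResolution J) :
    ∃ φ : ∀ i, (Fin (F.rank i) → MvPolynomial σ K) →ₗ[MvPolynomial σ K]
        (Fin (G.rank i) → MvPolynomial σ K),
      (∀ x, G.aug (φ 0 x) = F.aug x) ∧ ∀ i x, G.diff i (φ (i + 1) x) = φ i (F.diff i x) := by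
  obtain ⟨φ₀, h₀⟩ := LinearMap.exists_comp_eq F.aug G.aug fun x => by
    exact LinearMap.mem_range.1
      (G.range_aug.symm.le (F.range_aug.le (LinearMap.mem_range_self F.aug x)))
  let P : ∀ i, ((Fin (F.rank i) → MvPolynomial σ K) →ₗ[MvPolynomial σ K]
        (Fin (G.rank i) → MvPolynomial σ K)) → Prop :=
    fun i f => ∀ x, f (F.diff i x) ∈ Set.range (G.diff i)
  have hstep : ∀ i f, P i f → ∃ f', P (i + 1) f' ∧ ∀ x, G.diff i (f' x) = f (F.diff i x) := by
    intro i f hf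
    obtain ⟨f', hf'⟩ := LinearMap.exists_comp_eq (f ∘ₗ F.diff i) (G.diff i) hf
    refine ⟨f', fun x => ?_, hf'⟩
    rw [← G.exact_succ i, hf', LinearMap.comp_apply, (F.exact_succ i _).2 ⟨x, rfl⟩, map_zero]
  have hP₀ : P 0 φ₀ := fun x => by
    rw [← G.exact_zero, h₀, F.exact_zero]
    exact ⟨x, rfl⟩
  let φ : ∀ i, {f // P i f} := fun i => Nat.rec ⟨φ₀, hP₀⟩
    (fun i f => ⟨(hstep i f.1 f.2).choose, (hstep i f.1 f.2).choose_spec.1⟩) i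
  exact ⟨fun i => (φ i).1, h₀, fun i => (hstep i (φ i).1 (φ i).2).choose_spec.2⟩

/-- A chain endomorphism lifting zero vanishes modulo the variables. -/
theorem chainMap_apply_mem (F : MinimalGradedFreeResolution J)
    (χ : ∀ i, (Fin (F.rank i) → MvPolynomial σ K) →ₗ[MvPolynomial σ K]
        (Fin (F.rank i) → MvPolynomial σ K))
    (h₀ : ∀ x, F.aug (χ 0 x) = 0) (hχ : ∀ i x, F.diff i (χ (i + 1) x) = χ i (F.diff i x))
    (i : ℕ) : ∀ x k, χ i x k ∈ Ideal.span (Set.range (X : σ → MvPolynomial σ K)) := by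
  -- The strengthened claim carries a null-homotopy: χ = d h' + h d in each positive degree, and
  -- both terms vanish modulo the variables by minimality.
  suffices h : (∃ h : (Fin (F.rank i) → MvPolynomial σ K) →ₗ[MvPolynomial σ K]
        (Fin (F.rank (i + 1)) → MvPolynomial σ K),
      ∀ x, F.diff i (χ (i + 1) x - h (F.diff i x)) = 0) ∧
      ∀ x k, χ i x k ∈ Ideal.span (Set.range (X : σ → MvPolynomial σ K)) from h.2
  induction i with
  | zero =>
    obtain ⟨h, hh⟩ := LinearMap.exists_comp_eq (χ 0) (F.diff 0) fun x => (F.exact_zero _).1 (h₀ x)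
    refine ⟨⟨h, fun x => ?_⟩, fun x k => ?_⟩
    · rw [map_sub, hh, hχ, sub_self]
    · rw [← hh]
      exact F.minimal _ _ _
  | succ i ih =>
    obtain ⟨⟨h, hh⟩, -⟩ := ih
    obtain ⟨h', hh'⟩ := LinearMap.exists_comp_eq (χ (i + 1) - h ∘ₗ F.diff i) (F.diff (i + 1))
      fun x => (F.exact_succ _ _).1 (hh x)
    refine ⟨⟨h', fun x => ?_⟩, fun x k => ?_⟩
    · rw [map_sub, hh', hχ, LinearMap.sub_apply, LinearMap.comp_apply,
        (F.exact_succ i _).2 ⟨x, rfl⟩, map_zero, sub_zero, sub_self]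
    · have : χ (i + 1) x = F.diff (i + 1) (h' x) + h (F.diff i x) := by
        rw [hh', LinearMap.sub_apply, LinearMap.comp_apply, sub_add_cancel]
      rw [this]
      exact Ideal.add_mem _ (F.minimal _ _ _)
        (LinearMap.apply_mem_ideal _ _ (fun l => F.minimal _ _ _) _)

theorem mem_span_range_X_iff {r : MvPolynomial σ K} :
    r ∈ Ideal.span (Set.range (X : σ → MvPolynomial σ K)) ↔ constantCoeff r = 0 := by
  rw [← Set.image_univ, mem_ideal_span_X_image, constantCoeff_eq]
  constructor
  · intro h
    by_contra h0
    obtain ⟨i, -, hi⟩ := h 0 (mem_support_iff.2 h0)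
    exact hi rfl
  · intro h e he
    have he0 : e ≠ 0 := by
      rintro rfl
      exact mem_support_iff.1 he h
    obtain ⟨i, hi⟩ := Finsupp.ne_iff.1 he0
    exact ⟨i, Set.mem_univ _, hi⟩

/-- The composite ψφ is the identity modulo the variables, so φ reduces to an injective K-linear
map, and dimensions compare. -/
theorem rank_le (F G : MinimalGradedFreeResolution J) (i : ℕ) : F.rank i ≤ G.rank i := by
  obtain ⟨φ, hφ₀, hφ⟩ := F.exists_chainMap G
  obtain ⟨ψ, hψ₀, hψ⟩ := G.exists_chainMap F
  have hmem := F.chainMap_apply_mem (fun i => ψ i ∘ₗ φ i - LinearMap.id)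
    (fun x => by simp [hψ₀, hφ₀]) (fun i x => by simp [hψ, hφ]) i
  let Φ : (Fin (F.rank i) → K) →ₗ[K] (Fin (G.rank i) → K) :=
    { toFun := fun x k => constantCoeff (φ i (fun l => C (x l)) k)
      map_add' := fun x y => by
        ext k
        have : (fun l => C ((x + y) l) : Fin (F.rank i) → MvPolynomial σ K) =
            (fun l => C (x l)) + fun l => C (y l) := by ext1 l; simp
        rw [this, map_add]
        simp
      map_smul' := fun c x => by
        ext k
        have : (fun l => C ((c • x) l) : Fin (F.rank i) → MvPolynomial σ K) =
            (C c : MvPolynomial σ K) • fun l => C (x l) := by ext1 l; simp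
        rw [this, map_smul]
        simp }
  have hinj : Function.Injective Φ := by
    rw [← LinearMap.ker_eq_bot, LinearMap.ker_eq_bot']
    intro x hx
    ext l
    have h1 : ∀ k, φ i (fun l => C (x l)) k ∈
        Ideal.span (Set.range (X : σ → MvPolynomial σ K)) := fun k =>
      mem_span_range_X_iff.2 (congrFun hx k)
    have h2 := LinearMap.apply_mem_ideal _ (ψ i) h1 l
    have h3 := Ideal.sub_mem _ h2 (hmem (fun l => C (x l)) l)
    simpa [mem_span_range_X_iff] using h3
  simpa using LinearMap.finrank_le_finrank_of_injective hinj

theorem rank_eq (F G : MinimalGradedFreeResolution J) (i : ℕ) : F.rank i = G.rank i :=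
  le_antisymm (F.rank_le G i) (G.rank_le F i)

end MinimalGradedFreeResolution

end ComparisonOfResolutions

/-! ### From linear resolutions to minimal graded free resolutions -/

section InDegree

variable {K σ : Type*} [Field K]

theorem InDegree.sum {ι : Type*} {s : Finset ι} {z : ℤ} {f : ι → MvPolynomial σ K}
    (h : ∀ i ∈ s, InDegree z (f i)) : InDegree z (∑ i ∈ s, f i) := by
  -- For negative `z` every summand is zero.
  by_cases hz : ∃ e : ℕ, (e : ℤ) = z
  · obtain ⟨e, rfl⟩ := hz
    refine Or.inr ⟨e, rfl, IsHomogeneous.sum _ _ _ fun i hi => ?_⟩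
    rcases h i hi with h | ⟨e', he', h⟩
    · rw [h]
      exact isHomogeneous_zero _ _ _
    · exact Nat.cast_injective he' ▸ h
  · refine Or.inl (Finset.sum_eq_zero fun i hi => (h i hi).resolve_right ?_)
    rintro ⟨e, he, -⟩
    exact hz ⟨e, he⟩

theorem InDegree.homogeneous_mul {z w : ℤ} {a : ℕ} {p r : MvPolynomial σ K}
    (hp : p.IsHomogeneous a) (hr : InDegree w r) (hz : z = a + w) : InDegree z (p * r) := by
  rcases hr with rfl | ⟨e, rfl, hr⟩
  · exact Or.inl (mul_zero p)
  · exact Or.inr ⟨a + e, by rw [hz]; push_cast; rfl, hp.mul hr⟩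

end InDegree

section Conversion

variable {K σ : Type*} [Field K] {J : Ideal (MvPolynomial σ K)} {q : ℕ}

/-- The matrices of a linear resolution, indexed by `Fin`. -/
noncomputable def LinearResolution.finD (F : LinearResolution J q) (i : ℕ) :
    Matrix (Fin (Fintype.card (F.ι i))) (Fin (Fintype.card (F.ι (i + 1)))) (MvPolynomial σ K) :=
  (F.D i).submatrix (Fintype.equivFin _).symm (Fintype.equivFin _).symm

theorem LinearResolution.finD_mulVec (F : LinearResolution J q) (i : ℕ) (v) :
    F.finD i *ᵥ v = (F.D i *ᵥ (v ∘ Fintype.equivFin _)) ∘ (Fintype.equivFin _).symm :=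
  Matrix.submatrix_mulVec_equiv _ _ _ _

theorem LinearResolution.finAug_dotProduct (F : LinearResolution J q) (v) :
    (F.aug ∘ (Fintype.equivFin _).symm) ⬝ᵥ v = F.aug ⬝ᵥ (v ∘ Fintype.equivFin _) := by
  rw [comp_equiv_symm_dotProduct]

/-- A linear resolution as a minimal graded free resolution. -/
noncomputable def LinearResolution.toMinimalGradedFreeResolution (F : LinearResolution J q) :
    MinimalGradedFreeResolution J where
  rank i := Fintype.card (F.ι i)
  -- Linear matrices raise the generator degree by one at each step, and linear forms have no
  -- constant term, whence minimality.
  deg i _ := q + i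
  diff i := (F.finD i).mulVecLin
  aug := dotProductBilin (MvPolynomial σ K) (MvPolynomial σ K)
    (F.aug ∘ (Fintype.equivFin _).symm)
  range_aug := by
    ext r
    rw [F.mem_iff, LinearMap.mem_range]
    constructor
    · rintro ⟨v, hv⟩
      exact ⟨_, (F.finAug_dotProduct v).symm.trans hv⟩
    · rintro ⟨v, hv⟩
      refine ⟨v ∘ (Fintype.equivFin _).symm, (F.finAug_dotProduct _).trans ?_⟩
      simpa [Function.comp_assoc] using hv
  exact_zero := by
    intro v
    refine (Iff.of_eq (congrArg (· = 0) (F.finAug_dotProduct v))).trans ((F.exact_zero _).trans ?_)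
    constructor
    · rintro ⟨w, hw⟩
      refine ⟨w ∘ (Fintype.equivFin _).symm, (F.finD_mulVec 0 _).trans ?_⟩
      simp only [Function.comp_assoc, Equiv.symm_comp_self, Function.comp_id, hw,
        Equiv.self_comp_symm]
    · rintro ⟨w, rfl⟩
      refine ⟨w ∘ Fintype.equivFin _, ?_⟩
      rw [Matrix.mulVecLin_apply, F.finD_mulVec, Function.comp_assoc, Equiv.symm_comp_self,
        Function.comp_id]
  exact_succ := by
    intro i v
    have h0 : F.finD i *ᵥ v = 0 ↔ F.D i *ᵥ (v ∘ Fintype.equivFin _) = 0 := by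
      rw [F.finD_mulVec]
      refine ⟨fun h => funext fun k => ?_, fun h => by rw [h]; rfl⟩
      simpa using congrFun h (Fintype.equivFin _ k)
    refine h0.trans ((F.exact_succ i _).trans ?_)
    constructor
    · rintro ⟨w, hw⟩
      refine ⟨w ∘ (Fintype.equivFin _).symm, (F.finD_mulVec (i + 1) _).trans ?_⟩
      simp only [Function.comp_assoc, Equiv.symm_comp_self, Function.comp_id, hw,
        Equiv.self_comp_symm]
    · rintro ⟨w, rfl⟩
      refine ⟨w ∘ Fintype.equivFin _, ?_⟩
      rw [Matrix.mulVecLin_apply, F.finD_mulVec, Function.comp_assoc, Equiv.symm_comp_self,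
        Function.comp_id]
  aug_graded := by
    intro z v hv
    change InDegree z (∑ k, F.aug ((Fintype.equivFin _).symm k) * v k)
    exact InDegree.sum fun k _ => (hv k).homogeneous_mul (F.aug_hom _) (by simp)
  diff_graded := by
    intro i z v hv k
    change InDegree _ (∑ l, F.finD i k l * v l)
    refine InDegree.sum fun l _ => (hv l).homogeneous_mul (F.D_hom _ _ _) ?_
    push_cast
    ring
  minimal := by
    intro i v k
    change ∑ l, F.finD i k l * v l ∈ _
    refine Ideal.sum_mem _ fun l _ => Ideal.mul_mem_right _ _ ?_
    rw [MinimalGradedFreeResolution.mem_span_range_X_iff, constantCoeff_eq]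
    exact (F.D_hom _ _ _).coeff_eq_zero (by simp)

theorem HasLinearResolution.hasTotalBettiNumbers {β : ℕ → ℕ} (h : HasLinearResolution J q β) :
    HasTotalBettiNumbers J β := by
  obtain ⟨F, hF⟩ := h
  refine ⟨⟨F.toMinimalGradedFreeResolution⟩, fun G i => ?_⟩
  rw [← hF]
  exact G.rank_eq F.toMinimalGradedFreeResolution i

end Conversion

/-! ### Supports of exponent vectors bounded by M, and pathological generators -/

section StarLinearization

variable {K σ : Type*} [Field K]

theorem monomial_mem_squarefreeIdeal {S : Set (Finset σ)} {A : Finset σ} (hA : A ∈ S)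
    {e : σ →₀ ℕ} (h : A ⊆ e.support) : monomial e (1 : K) ∈ squarefreeIdeal K S := by
  rw [mem_squarefreeIdeal]
  intro e' he'
  rw [Finset.mem_singleton.1 (support_monomial_subset he')]
  exact ⟨A, hA, h⟩

theorem monomial_squarefreeExponent_mem_radical {I : Ideal (MvPolynomial σ K)} {e : σ →₀ ℕ}
    (he : monomial e (1 : K) ∈ I) {A : Finset σ} (hA : e.support ⊆ A) :
    monomial (squarefreeExponent A) (1 : K) ∈ I.radical := by
  classical
  -- No single exponent of e exceeds its total degree, so this power is divisible by the monomial of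
  -- e.
  refine ⟨e.degree, ?_⟩
  have hle : e ≤ e.degree • squarefreeExponent A := by
    intro i
    by_cases hi : i ∈ A
    · simpa [squarefreeExponent_apply, hi] using Finsupp.le_degree i e
    · have : e i = 0 := by simpa using fun h => hi (hA h)
      simp [this]
  rw [monomial_pow, one_pow, ← add_tsub_cancel_of_le hle, ← one_mul (1 : K), ← monomial_mul]
  exact Ideal.mul_mem_right _ _ he

theorem support_xExponent {n : ℕ} (m : ℕ) (u : Fin n →₀ ℕ) :
    (xExponent m u).support = u.support.map Function.Embedding.inl := by
  classical
  rw [xExponent, Finsupp.mapDomain_support_of_injective Sum.inl_injective, Finset.map_eq_image]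
  rfl

theorem support_xExponent_add_single {n m : ℕ} (u : Fin n →₀ ℕ) (j : Fin m) :
    (xExponent m u + Finsupp.single (Sum.inr j) 1).support = u.support.disjSum {j} := by
  classical
  have hz : ∀ y, xExponent m u (Sum.inr y) = 0 := fun y =>
    Finsupp.mapDomain_of_notMem_range _ _ (by simp)
  have hx : ∀ x, xExponent m u (Sum.inl x) = u x := fun x =>
    Finsupp.mapDomain_apply Sum.inl_injective _ _
  ext (x | y)
  · simp [hx]
  · simp [hz, Finsupp.single_apply, eq_comm]

theorem sum_le_card_support_mul {n M : ℕ} {u : Fin n →₀ ℕ} (hu : ∀ i, u i ≤ M) :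
    ∑ i, u i ≤ u.support.card * M := by
  rw [← Finsupp.degree_eq_sum, Finsupp.degree_apply]
  exact Finset.sum_le_card_nsmul _ _ _ fun i _ => hu i

theorem eq_of_sum_eq_card_support_mul {n M : ℕ} {u : Fin n →₀ ℕ} (hu : ∀ i, u i ≤ M)
    (h : ∑ i, u i = u.support.card * M) {i : Fin n} (hi : u i ≠ 0) : u i = M := by
  rw [← Finsupp.degree_eq_sum, Finsupp.degree_apply, ← smul_eq_mul, ← Finset.sum_const] at h
  exact (Finset.sum_eq_sum_iff_of_le fun i _ => hu i).1 h i (Finsupp.mem_support_iff.2 hi)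

/-- A finite set `B` supports an exponent vector of any degree at most `|B| M` with entries
at most `M`. -/
theorem exists_sum_eq_of_le {n M : ℕ} (B : Finset (Fin n)) :
    ∀ d, d ≤ B.card * M → ∃ u : Fin n →₀ ℕ, ∑ i, u i = d ∧ (∀ i, u i ≤ M) ∧ u.support ⊆ B := by
  classical
  induction B using Finset.induction_on with
  | empty =>
    intro d hd
    exact ⟨0, by simp at hd; simp [hd], by simp, by simp⟩
  | insert x B hx ih =>
    intro d hd
    rw [Finset.card_insert_of_notMem hx, add_mul, one_mul] at hd
    -- Greedy filling: x receives min(d, M), and the rest still fits on B.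
    obtain ⟨u, hu, huM, hs⟩ := ih (d - min d M) (by omega)
    have hux : u x = 0 := by simpa using fun h => hx (hs h)
    refine ⟨u + Finsupp.single x (min d M), ?_, fun i => ?_, ?_⟩
    · simp only [Finsupp.add_apply, Finset.sum_add_distrib, hu]
      simp [Finsupp.single_apply]
    · by_cases hi : x = i
      · subst hi
        simp [hux]
      · simpa [Finsupp.single_apply, hi] using huM i
    · refine Finsupp.support_add.trans (Finset.union_subset
        (hs.trans (Finset.subset_insert _ _)) (Finsupp.support_single_subset.trans ?_))
      simp

variable {n M : ℕ} {u : Fin n →₀ ℕ} {k : Fin n}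

/-- As M ≥ 2, the exponents 0, 1 and M are distinct, so the simple variable is unique. -/
theorem IsPathological.eq_zero_or_eq (hM : 2 ≤ M) (hu : IsPathological M u) (hk : u k = 1)
    {l : Fin n} (hl : l ≠ k) : u l = 0 ∨ u l = M := by
  obtain ⟨k', hk', h⟩ := hu
  obtain rfl : k = k' := by
    by_contra hne
    rcases h k hne with h | h <;> omega
  exact h l hl

/-- The quotient has only exponents 0 and M, so its support determines it; coincidences of quotients
become equalities of supports. -/
theorem IsPathological.sub_single_apply (hM : 2 ≤ M) (hu : IsPathological M u) (hk : u k = 1)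
    (i : Fin n) : (u - Finsupp.single k 1 : Fin n →₀ ℕ) i = if i ∈ u.support.erase k then M else 0 := by
  by_cases hi : i = k
  · subst hi
    simp [hk]
  · rcases hu.eq_zero_or_eq hM hk hi with h | h
    · simp [h]
    · have : M ≠ 0 := by omega
      simp [h, hi, this]

theorem IsPathological.support_sub_single (hM : 2 ≤ M) (hu : IsPathological M u) (hk : u k = 1) :
    (u - Finsupp.single k 1 : Fin n →₀ ℕ).support = u.support.erase k := by
  ext i
  have : M ≠ 0 := by omega
  rw [Finsupp.mem_support_iff, hu.sub_single_apply hM hk]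
  simp [this]

theorem sum_sub_single {d : ℕ} (hd : ∑ i, u i = d) (hk : 1 ≤ u k) :
    ∑ i, (u - Finsupp.single k 1 : Fin n →₀ ℕ) i + 1 = d := by
  have h : u - Finsupp.single k 1 + Finsupp.single k 1 = u :=
    tsub_add_cancel_of_le (by simpa using hk)
  rw [← hd]
  conv_rhs => rw [← h]
  simp [Finset.sum_add_distrib, Finsupp.single_apply]

/-- Compare |A| M + 1 = a M + b modulo M. A pathological generator therefore forces q = a + 1, the
degree of x_A y_j. -/
theorem IsPathological.card_and_remainder {d a b : ℕ} (hM : 2 ≤ M) (hu : IsPathological M u)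
    (hk : u k = 1) (hd : ∑ i, u i = d) (hab : d = a * M + b) (hb : b < M) :
    (u.support.erase k).card = a ∧ b = 1 := by
  have h := sum_sub_single hd hk.ge
  simp only [hu.sub_single_apply hM hk] at h
  rw [Finset.sum_ite_mem, Finset.univ_inter, Finset.sum_const, smul_eq_mul, hab] at h
  have h1 : b = 1 := by
    have := congrArg (· % M) h
    simpa [Nat.add_mod, Nat.mod_eq_of_lt hb, Nat.mod_eq_of_lt (show 1 < M by omega),
      eq_comm] using this
  subst h1
  exact ⟨Nat.eq_of_mul_eq_mul_right (by omega) (Nat.add_right_cancel h), rfl⟩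

/-- If `u / x_k` has too small a support then `u` is pathological with simple variable `x_k`. -/
theorem isPathological_of_card_support_lt {d a b : ℕ} (hM : 2 ≤ M) (huM : ∀ i, u i ≤ M)
    (hk : 1 ≤ u k) (hd : ∑ i, u i = d) (hab : d = a * M + b)
    (hcard : (u - Finsupp.single k 1 : Fin n →₀ ℕ).support.card < a + natSign b) :
    IsPathological M u ∧ u k = 1 := by
  set v : Fin n →₀ ℕ := u - Finsupp.single k 1 with hv
  have hvu : ∀ i, v i = u i - if k = i then 1 else 0 := fun i => by
    simp [hv, Finsupp.single_apply]
  have hvM : ∀ i, v i ≤ M := fun i => by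
    rw [hvu]
    exact (Nat.sub_le _ _).trans (huM i)
  have hsum : ∑ i, v i + 1 = d := sum_sub_single hd hk
  have hle := sum_le_card_support_mul hvM
  -- For b > 0 the support has at most a elements and a M ≤ d - 1. For b = 0 its capacity is at most
  -- d - M < d - 1, contradicting `hle`.
  have heq : ∑ i, v i = v.support.card * M := by
    refine le_antisymm hle ?_
    unfold natSign at hcard
    split_ifs at hcard with hb
    · have : v.support.card * M ≤ a * M := Nat.mul_le_mul_right _ (by omega)
      omega
    · have : (v.support.card + 1) * M ≤ a * M := Nat.mul_le_mul_right _ (by omega)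
      rw [add_mul] at this
      omega
  have hfull : ∀ i, v i ≠ 0 → v i = M := fun i hi => eq_of_sum_eq_card_support_mul hvM heq hi
  -- Otherwise x_k remains with exponent u k - 1, which is nonzero but less than M.
  have hk1 : u k = 1 := by
    have h1 := hvu k
    have h2 := huM k
    have h3 := hfull k
    simp only [if_true] at h1
    by_contra hne
    have := h3 (by omega)
    omega
  refine ⟨⟨k, hk1, fun l hl => ?_⟩, hk1⟩
  have h1 := hvu l
  rw [if_neg (Ne.symm hl), Nat.sub_zero] at h1
  rw [← h1]
  exact or_iff_not_imp_left.2 (hfull l)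

end StarLinearization

/-! ### The radical of the *-linearization -/

section Radical

variable {K : Type*} [Field K] {n m d M a b p : ℕ} {f : Fin m → (Fin n →₀ ℕ)}

theorem monomial_xExponent_mul_X {u : Fin n →₀ ℕ} (j : Fin m) :
    monomial (xExponent m u) (1 : K) * X (Sum.inr j) =
      monomial (xExponent m u + Finsupp.single (Sum.inr j) 1) 1 := by
  rw [X, monomial_mul, one_mul]

theorem starLinearization_radical (hd : ∀ j, (∑ i, f j i) = d) (hfM : ∀ j i, f j i ≤ M)
    (hab : d = a * M + b) (hb : b < M) (hM2 : 2 ≤ M)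
    (j : Fin p → Fin m) (hp : Set.range j = {q | IsPathological M (f q)})
    (k : Fin p → Fin n) (hk : ∀ l, f (j l) (k l) = 1) :
    (starLinearization K d M f).radical =
      squarefreeIdeal K (veroneseSupports n m (a + natSign b) ∪
        Set.range fun l => ((f (j l)).support.erase (k l)).disjSum {j l}) := by
  classical
  have hpath : ∀ l, IsPathological M (f (j l)) := fun l => hp.le ⟨l, rfl⟩
  have hqM : d ≤ (a + natSign b) * M := by
    unfold natSign
    split_ifs with h
    · rw [add_mul, one_mul]
      omega
    · rw [add_zero]
      omega
  have hlarge : ∀ (u : Fin n →₀ ℕ) (e : Fin n ⊕ Fin m →₀ ℕ), a + natSign b ≤ u.support.card →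
      u.support.map Function.Embedding.inl ⊆ e.support →
      monomial e (1 : K) ∈ squarefreeIdeal K (veroneseSupports n m (a + natSign b) ∪
        Set.range fun l => ((f (j l)).support.erase (k l)).disjSum {j l}) := by
    intro u e hu he
    obtain ⟨B, hB, hBc⟩ := Finset.exists_subset_card_eq hu
    exact monomial_mem_squarefreeIdeal (Or.inl ⟨B, hBc, rfl⟩)
      ((Finset.map_subset_map.2 hB).trans he)
  apply le_antisymm
  · rw [(squarefreeIdeal_isRadical _).radical_le_iff, starLinearization, sup_le_iff,
      Ideal.span_le, Ideal.span_le]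
    constructor
    · rintro _ ⟨u, hu, huM, rfl⟩
      refine hlarge u _ ?_ (support_xExponent m u).ge
      have h := sum_le_card_support_mul huM
      rw [hu, hab] at h
      unfold natSign
      split_ifs with hb0
      · by_contra! hlt
        have : u.support.card * M ≤ a * M := Nat.mul_le_mul_right _ (by omega)
        omega
      · exact Nat.le_of_mul_le_mul_right ((Nat.le_add_right _ _).trans h) (by omega)
    · rintro _ ⟨j', k', hjk, rfl⟩
      rw [monomial_xExponent_mul_X]
      -- A large support is absorbed by the Veronese part; a small one comes from a pathological
      -- generator.
      by_cases hc : a + natSign b ≤ (f j' - Finsupp.single k' 1 : Fin n →₀ ℕ).support.card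
      · refine hlarge _ _ hc ?_
        rw [support_xExponent_add_single]
        intro x hx
        obtain ⟨y, hy, rfl⟩ := Finset.mem_map.1 hx
        exact Finset.inl_mem_disjSum.2 hy
      · obtain ⟨hP, hk1⟩ := isPathological_of_card_support_lt hM2 (hfM j') hjk (hd j') hab
          (not_le.1 hc)
        obtain ⟨l, rfl⟩ := hp.ge hP
        have hkl : k l = k' := by
          by_contra hne
          rcases hP.eq_zero_or_eq hM2 hk1 hne with h | h <;> rw [hk l] at h <;> omega
        refine monomial_mem_squarefreeIdeal (Or.inr ⟨l, rfl⟩) ?_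
        rw [support_xExponent_add_single, hP.support_sub_single hM2 hk1, ← hkl]
  · rw [squarefreeIdeal, Ideal.span_le]
    rintro _ ⟨A, ⟨B, hB, rfl⟩ | ⟨l, rfl⟩, rfl⟩
    · obtain ⟨u, hu, huM, hs⟩ := exists_sum_eq_of_le (M := M) B d (by rwa [hB])
      refine monomial_squarefreeExponent_mem_radical (e := xExponent m u)
        ?_ ?_
      · exact Ideal.mem_sup_left (Ideal.subset_span ⟨u, hu, huM, rfl⟩)
      · rw [support_xExponent]
        exact Finset.map_subset_map.2 hs
    · refine monomial_squarefreeExponent_mem_radical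
        (e := xExponent m (f (j l) - Finsupp.single (k l) 1) + Finsupp.single (Sum.inr (j l)) 1)
        ?_ ?_
      · exact Ideal.mem_sup_right (Ideal.subset_span ⟨j l, k l, (hk l).ge,
          (monomial_xExponent_mul_X _).symm⟩)
      · rw [support_xExponent_add_single, (hpath l).support_sub_single hM2 (hk l)]

end Radical

theorem corollary3p14 {K : Type*} [Field K] (n m d M a b p : ℕ)
    (I : Ideal (MvPolynomial (Fin n) K)) (hI : IsMonomialIdeal I)
    (f : Fin m → (Fin n →₀ ℕ)) (hf : Function.Injective f)
    (hG : Set.range f = minimalGenerators I)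
    (hd : ∀ j, (∑ i, f j i) = d)
    (hM : IsGreatest {e | ∃ j i, f j i = e} M)
    (hab : d = a * M + b) (hb : b < M) (ha : 1 ≤ a) (hM2 : 2 ≤ M)
    (j : Fin p → Fin m) (hj : Function.Injective j)
    (hp : Set.range j = {q | IsPathological M (f q)})
    (k : Fin p → Fin n) (hk : ∀ l, f (j l) (k l) = 1) :
    HasTotalBettiNumbers (starLinearization K d M f).radical
      (fun i =>
        (i + a + natSign b - 1).choose (a + natSign b - 1) * n.choose (i + a + natSign b)
          + ∑ l : Fin p, (n - a + earlierCoincidences f j k l).choose i) := by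
  classical
  have hfM : ∀ q i, f q i ≤ M := fun q i => hM.2 ⟨q, i, rfl⟩
  have hpath : ∀ l, IsPathological M (f (j l)) := fun l => hp.le ⟨l, rfl⟩
  have hcard := fun l => (hpath l).card_and_remainder hM2 (hk l) (hd _) hab hb
  have hsign : ∀ l : Fin p, natSign b = 1 := fun l => by simp [natSign, (hcard l).2]
  obtain ⟨c, hc⟩ : ∃ c, a + natSign b = c + 1 := ⟨a + natSign b - 1, by omega⟩
  -- This is claimed only in the presence of an index `l`: without pathological generators b may be
  -- 0, and then c = a - 1.
  have hca : ∀ l : Fin p, c = a := fun l => by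
    have := hsign l
    omega
  have hcoinc : ∀ l, (Finset.univ.filter fun s : Fin p => s < l ∧
      (f (j s)).support.erase (k s) = (f (j l)).support.erase (k l)).card =
        earlierCoincidences f j k l := by
    intro l
    refine congrArg Finset.card (Finset.filter_congr fun s _ => and_congr_right fun _ => ?_)
    rw [← (hpath s).support_sub_single hM2 (hk s), ← (hpath l).support_sub_single hM2 (hk l)]
    refine ⟨fun h => ?_, fun h => by rw [h]⟩
    ext1 i
    rw [(hpath s).sub_single_apply hM2 (hk s), (hpath l).sub_single_apply hM2 (hk l),
      ← (hpath s).support_sub_single hM2 (hk s), ← (hpath l).support_sub_single hM2 (hk l), h]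
  rw [starLinearization_radical hd hfM hab hb hM2 j hp k hk, hc]
  have key := (hasLinearResolution_veronese_union (K := K)
    (fun l => (f (j l)).support.erase (k l)) (fun l => (hcard l).1.trans (hca l).symm) j
    hj).hasTotalBettiNumbers
  convert key using 2 with i
  have h1 : i + a + natSign b = i + c + 1 := by omega
  rw [h1, Nat.add_sub_cancel, Nat.add_sub_cancel]
  refine congrArg _ (Finset.sum_congr rfl fun l _ => ?_)
  rw [hcoinc, hca l]
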